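/- Let $N\ge 1$, let $F$ be a field (for instance $\mathbb{C}$, or a field of rational functions in the parameters), and let $q,q_N,\kappa_N,\zeta_N\in F$ be non-zero. \emph{Vector side.} Let $V=Fv_+\oplus Fv_-$, and write $v_\epsilon=v_{\epsilon_1}\otimes\cdots\otimes v_{\epsilon_N}$ for $\epsilon\in\{\pm\}^N$. On $V^{\otimes N}$ let $e_i$ ($1\le i\le N-1$) act on the tensor factors $i,i+1$, in the ordered basis $(v_{++},v_{+-},v_{-+},v_{--})$, and let $e_N$ act on the last factor, in the ordered basis $(v_+,v_-)$, by $$\begin{pmatrix}0&0&0&0\\0&-q^{-1}&1&0\\0&1&-q&0\\0&0&0&0\end{pmatrix},\qquad \begin{pmatrix}-q_N^{-1}&\kappa_N\\ \kappa_N^{-1}&-q_N\end{pmatrix}.$$ Order $\{\pm\}^N$ lexicographically with $+$ before $-$, so that $b_0=(-\cdots-)$ is the largest string. \emph{Kazhdan--Lusztig bases.} The basis $(C_\epsilon)$ of $V^{\otimes N}$ is one of the following three. Read $-$ as a down arrow and $+$ as an up arrow, and connect adjacent pairs (down, up) by arcs as long as possible, ignoring arrows that are already connected. Each arc contributes $v_{-+}-q^{-1}v_{+-}$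 and each unpaired up arrow contributes $v_+$. Count the unpaired down arrows from the right. \begin{itemize} \item Type BI (where $q_N=q^M$ for an integer $M\ge1$): the $r$-th one, $r\le M$, contributes $v_--\kappa_Nq^{-(M+1-r)}v_+$. The remaining ones are paired from right to left, each pair contributing $v_{--}-\kappa_N^2q^{-1}v_{++}$; if one is left over it contributes $v_-$. \item Type BII: the $r$-th one contributes $v_--\kappa_Nq_N^{-1}v_+$ for $r$ odd and $v_-+\kappa_Nq^{-1}q_Nv_+$ for $r$ even. \item Type BIII: the $r$-th one contributes $v_--\kappa_Nq^{r-1}q_N^{-1}v_+$. \end{itemize} $C_\epsilon$ is the tensor product of these contributions. \emph{Function side.} For $z=(z_1,\ldots,z_N)$ let $s_iz$ be $z$ with $z_i,z_{i+1}$ exchanged if $i<N$, and let $s_Nz=(z_1,\ldots,z_{N-1},z_N^{-1})$. Let $\Omega\subseteq(F^\times)^N$ be stable under $s_1,\ldots,s_N$ and such that $z_i\ne z_{i+1}$ for $1\le i\le N-1$ and $z_N^2\neq1$ for all $z\in\Omega$. For $F$-valued functions $f$ of $z$ put $$\hat T_i f=-qf-q^{-1}\frac{1-q^2z_i/z_{i+1}}{1-z_i/z_{i+1}}\,(f\circ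 s_i-f)\quad(1\le i\le N-1),$$ $$\hat T_N f=-q_Nf-q_N^{-1}\frac{(1+q_N\zeta_Nz_N)(1-q_N\zeta_N^{-1}z_N)}{1-z_N^2}\,(f\circ s_N-f),$$ and $\hat e_i=\hat T_i-q_i^{-1}$, where $q_i=q$ for $i<N$. For a $V^{\otimes N}$-valued function $\Psi=\sum_b\Psi_bC_b$, the $e_i$ act on the vectors $C_b$ and the $\hat e_i$ act on the component functions $\Psi_b$. Write $\Psi_0=\Psi_{b_0}$. The \emph{non-affine part of the two-boundary qKZ equation} is $e_i\Psi=\hat e_i\Psi$ on $\Omega$ for $1\le i\le N$. \emph{Paths.} Let $s_i$ ($i<N$) exchange the letters $i$ and $i+1$ of a string, and let $s_N$ change its last letter. Let $\Gamma'$ be the graph on $\{\pm\}^N$ in which $\alpha\ne\beta$ are joined by an edge labelled $i$ if $\alpha=s_i\beta$. A path from $b_0$ to $v$ is a sequence $b_0=v_0>v_1>\cdots>v_l=v$ with $v_{j-1}$ and $v_j$ joined by an edge labelled $i_j$. \textbf{Proposition.} For every $v<b_0$ there is a path from $b_0$ to $v$. Fix, for every $v<b_0$, any such path $p_v$, with labels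 $(i_1,\ldots,i_l)$. Then the non-affine part of the two-boundary qKZ equation is equivalent to the following set of $2^N+N-2$ equations on $\Omega$: \begin{enumerate} \item $\hat e_i\Psi_0=0$ for $1\le i\le N-1$; \item for each $v<b_0$, with the labels of $p_v$, the path equation $$e_{i_1}e_{i_2}\cdots e_{i_l}\Psi=\hat e_{i_l}\cdots\hat e_{i_2}\hat e_{i_1}\Psi$$ at the basis vector $C_{b_0}$: the coefficient of $C_{b_0}$ in $e_{i_1}\cdots e_{i_l}\Psi$ equals $\hat e_{i_l}\cdots\hat e_{i_1}\Psi_0$. \end{enumerate} It is also equivalent to (1) together with the path equations in (2) taken in all of $V^{\otimes N}$, i.e. at every basis vector $C_b$. -/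

import Mathlib

noncomputable section

namespace BoundaryQKZ

/-- The two letters of a binary string. -/
inductive Sgn where
  | plus : Sgn
  | minus : Sgn
  deriving DecidableEq

open Sgn

instance : Fintype Sgn := ⟨{plus, minus}, fun a => by cases a <;> simp⟩

/-- The letter as a number in `{0, 1}`; it fixes the order `plus < minus` of the letters. -/
def Sgn.toBool : Sgn → Bool
  | plus => false
  | minus => true

theorem Sgn.toBool_injective : Function.Injective Sgn.toBool := by
  intro a b h
  cases a <;> cases b <;> simp_all [Sgn.toBool]

instance : LinearOrder Sgn := LinearOrder.lift' Sgn.toBool Sgn.toBool_injective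

/-- Binary strings of length `N`. Sites are numbered `0, …, N - 1`. The lexicographic order in which
`(+ ⋯ +)` comes first and `(- ⋯ -)` comes last is the order of `toLex`. -/
abbrev Str (N : ℕ) : Type := Fin N → Sgn

/-- The string `b₀ = (- ⋯ -)`, the largest one. -/
def b0 (N : ℕ) : Str N := fun _ => minus

/-- The parameters which occur in the non-affine part of the equation. All are non-zero. -/
structure Params (F : Type*) [Field F] where
  q : F
  qN : F
  κN : F
  ζN : F
  q_ne : q ≠ 0
  qN_ne : qN ≠ 0
  κN_ne : κN ≠ 0
  ζN_ne : ζN ≠ 0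

variable {F : Type*} [Field F] {N : ℕ}

/-! ### The space `V^{⊗ N}` and the generators `e_1, …, e_N`

`V^{⊗ N}` is the space `Str N → F`: the function `x` is the vector `∑ ε, x ε • v_ε`.
The index `i : Fin N` stands for the generator with the number `i + 1`, so that the indices with
`i + 1 < N` are the generators `e_1, …, e_{N-1}`, and the last index is `e_N`. -/

/-- The `4 × 4` matrix of `e_i`, `i < N`, on `V ⊗ V`: the entry in row `(a, b)`, column `(c, d)`. -/
def bulkEntry (P : Params F) : Sgn → Sgn → Sgn → Sgn → F
  | plus, minus, plus, minus => -P.q⁻¹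
  | plus, minus, minus, plus => 1
  | minus, plus, plus, minus => 1
  | minus, plus, minus, plus => -P.q
  | _, _, _, _ => 0

/-- The `2 × 2` matrix of `e_N` on `V`: the entry in row `a`, column `c`. -/
def bdryEntry (P : Params F) : Sgn → Sgn → F
  | plus, plus => -P.qN⁻¹
  | plus, minus => P.κN
  | minus, plus => P.κN⁻¹
  | minus, minus => -P.qN

/-- The generators of the two-boundary Temperley–Lieb algebra other than `e_0`,
acting on `V^{⊗ N}`. -/
def e (P : Params F) (i : Fin N) : (Str N → F) →ₗ[F] (Str N → F) where
  toFun x := fun α =>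
    if h : i.val + 1 < N then
      ∑ c : Sgn, ∑ d : Sgn, bulkEntry P (α i) (α ⟨i.val + 1, h⟩) c d *
        x (Function.update (Function.update α i c) ⟨i.val + 1, h⟩ d)
    else
      ∑ c : Sgn, bdryEntry P (α i) c * x (Function.update α i c)
  map_add' x y := by
    funext α
    by_cases h : i.val + 1 < N <;> simp [h, mul_add, Finset.sum_add_distrib]
  map_smul' r x := by
    funext α
    by_cases h : i.val + 1 < N <;> simp [h, Finset.mul_sum, mul_left_comm]

/-! ### Kazhdan–Lusztig bases -/

/-- The three types of Kazhdan–Lusztig bases. For type BI the number `M` is the one in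
`q_N = q^M`. -/
inductive KLType where
  | BI (M : ℕ) : KLType
  | BII : KLType
  | BIII : KLType

/-- The relation `q_N = q^M`, `M ≥ 1`, of type BI; nothing is required for the other two types. -/
def KLType.Compatible : KLType → Params F → Prop
  | .BI M, P => 1 ≤ M ∧ P.qN = P.q ^ M
  | .BII, _ => True
  | .BIII, _ => True

open scoped Classical in
/-- (number of down arrows) - (number of up arrows) at the sites `k` with `i ≤ k ≤ j`. -/
def excess (ε : Str N) (i j : Fin N) : ℤ :=
  ∑ k ∈ Finset.Icc i j, (if ε k = minus then 1 else -1)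

/-- A down arrow at `i` and an up arrow at `j` are paired (as an opening and a closing parenthesis):
this is the outcome of connecting adjacent pairs "down, up" as long as there are any. -/
def Arc (ε : Str N) (i j : Fin N) : Prop :=
  i < j ∧ ε i = minus ∧ ε j = plus ∧ excess ε i j = 0 ∧
    ∀ k : Fin N, i ≤ k → k < j → 0 < excess ε i k

/-- The site `i` is not on an arc. -/
def Unpaired (ε : Str N) (i : Fin N) : Prop := ∀ j : Fin N, ¬ Arc ε i j ∧ ¬ Arc ε j i

/-- An unpaired down arrow. -/
def FreeDown (ε : Str N) (i : Fin N) : Prop := Unpaired ε i ∧ ε i = minus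

open scoped Classical in
/-- An unpaired down arrow at `i` is the `rank ε i`-th one from the right. -/
def rank (ε : Str N) (i : Fin N) : ℕ :=
  (Finset.univ.filter (fun k : Fin N => i ≤ k ∧ FreeDown ε k)).card

/-- Unpaired down arrows at `i < j` connected by a dashed arc. This occurs for type BI only:
leave out the `M` rightmost unpaired down arrows and pair the remaining ones from right to left. -/
def DashedArc : KLType → Str N → Fin N → Fin N → Prop
  | .BI M, ε, i, j => FreeDown ε i ∧ FreeDown ε j ∧ M < rank ε j ∧ Odd (rank ε j - M) ∧
      rank ε i = rank ε j + 1
  | .BII, _, _, _ => False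
  | .BIII, _, _, _ => False

/-- The vector `v_{-+} - q⁻¹ v_{+-}` of an arc. -/
def arcWeight (P : Params F) : Sgn → Sgn → F
  | minus, plus => 1
  | plus, minus => -P.q⁻¹
  | _, _ => 0

/-- The vector `v_{--} - κ_N² q⁻¹ v_{++}` of a dashed arc. -/
def dashedWeight (P : Params F) : Sgn → Sgn → F
  | minus, minus => 1
  | plus, plus => -(P.κN ^ 2 * P.q⁻¹)
  | _, _ => 0

/-- The coefficient `c` in the vector `v_- + c v_+` of the `r`-th unpaired down arrow from the right
which is not on a dashed arc. For type BI it carries the integer `p = M + 1 - r` if `r ≤ M`, and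
is a plain down arrow otherwise; for type BII it carries "o" or "e" according to the parity of `r`;
for type BIII it carries the circled integer `r`. -/
def downCoeff (P : Params F) : KLType → ℕ → F
  | .BI M, r => if r ≤ M then -(P.κN * P.q⁻¹ ^ (M + 1 - r)) else 0
  | .BII, r => if Odd r then -(P.κN * P.qN⁻¹) else P.κN * P.q⁻¹ * P.qN
  | .BIII, r => -(P.κN * P.q ^ (r - 1) * P.qN⁻¹)

/-- The vector of a site which is on no arc and on no dashed arc: `v_+` for an up arrow and
`v_- + c v_+` for a down arrow. -/
def siteWeight (P : Params F) (X : KLType) (r : ℕ) : Sgn → Sgn → F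
  | plus, plus => 1
  | plus, minus => 0
  | minus, minus => 1
  | minus, plus => downCoeff P X r

open scoped Classical in
/-- The coefficient of `v_{ε'}` in `C_ε`, the tensor product of the vectors of the building blocks of
the diagram of `ε`. -/
def klCoeff (P : Params F) (X : KLType) (ε ε' : Str N) : F :=
  (∏ i : Fin N, ∏ j : Fin N, if Arc ε i j then arcWeight P (ε' i) (ε' j) else 1) *
  (∏ i : Fin N, ∏ j : Fin N, if DashedArc X ε i j then dashedWeight P (ε' i) (ε' j) else 1) *
  ∏ i : Fin N, if Unpaired ε i ∧ ∀ j : Fin N, ¬ DashedArc X ε i j ∧ ¬ DashedArc X ε j i then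
    siteWeight P X (rank ε i) (ε i) (ε' i) else 1

/-- The Kazhdan–Lusztig vectors `C_ε ∈ V^{⊗ N}`. -/
def klVec (P : Params F) (X : KLType) (ε : Str N) : Str N → F := fun ε' => klCoeff P X ε ε'

/- The vectors `C_ε` are unitriangular with respect to the `v_ε`, hence a basis. -/

theorem DashedArc.minus {X : KLType} {ε : Str N} {i j : Fin N} (h : DashedArc X ε i j) :
    ε i = Sgn.minus ∧ ε j = Sgn.minus := by
  cases X with
  | BI M => exact ⟨h.1.2, h.2.1.2⟩
  | BII => exact h.elim
  | BIII => exact h.elim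

theorem klCoeff_self (P : Params F) (X : KLType) (ε : Str N) : klCoeff P X ε ε = 1 := by
  classical
  unfold klCoeff
  have h1 : ∀ i j : Fin N, (if Arc ε i j then arcWeight P (ε i) (ε j) else (1 : F)) = 1 := by
    intro i j
    split_ifs with h
    · rw [h.2.1, h.2.2.1]; rfl
    · rfl
  have h2 : ∀ i j : Fin N,
      (if DashedArc X ε i j then dashedWeight P (ε i) (ε j) else (1 : F)) = 1 := by
    intro i j
    split_ifs with h
    · rw [h.minus.1, h.minus.2]; rfl
    · rfl
  have h3 : ∀ i : Fin N, siteWeight P X (rank ε i) (ε i) (ε i) = (1 : F) := by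
    intro i
    cases ε i <;> rfl
  simp [h1, h2, h3]

theorem klCoeff_eq_zero (P : Params F) (X : KLType) (ε ε' : Str N)
    (h : toLex ε < toLex ε') : klCoeff P X ε ε' = 0 := by
  classical
  obtain ⟨i, hlt, hi⟩ := h
  have hlt' : ∀ j < i, ε j = ε' j := hlt
  have hi' : ε i < ε' i := hi
  have hp : ε i = plus ∧ ε' i = minus := by
    revert hi'
    generalize ε i = a
    generalize ε' i = b
    revert a b
    decide
  by_cases hu : Unpaired ε i
  · have h3 : (if Unpaired ε i ∧ ∀ j : Fin N, ¬ DashedArc X ε i j ∧ ¬ DashedArc X ε j i then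
        siteWeight P X (rank ε i) (ε i) (ε' i) else (1 : F)) = 0 := by
      rw [if_pos, hp.1, hp.2]
      · rfl
      · refine ⟨hu, fun j => ⟨fun hd => ?_, fun hd => ?_⟩⟩
        · have := hd.minus.1
          rw [hp.1] at this
          cases this
        · have := hd.minus.2
          rw [hp.1] at this
          cases this
    unfold klCoeff
    exact mul_eq_zero_of_right _ (Finset.prod_eq_zero (Finset.mem_univ i) h3)
  · unfold Unpaired at hu
    push Not at hu
    obtain ⟨k, hk⟩ := hu
    have hki : Arc ε k i := by
      by_cases h : Arc ε i k
      · have := h.2.1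
        rw [hp.1] at this
        cases this
      · exact hk h
    have hk' : ε' k = minus := by rw [← hlt' k hki.1, hki.2.1]
    have h1 : (if Arc ε k i then arcWeight P (ε' k) (ε' i) else (1 : F)) = 0 := by
      rw [if_pos hki, hk', hp.2]
      rfl
    unfold klCoeff
    rw [Finset.prod_eq_zero (Finset.mem_univ k) (Finset.prod_eq_zero (Finset.mem_univ i) h1),
      zero_mul, zero_mul]

theorem klVec_linearIndependent (P : Params F) (X : KLType) :
    LinearIndependent F (klVec P X : Str N → Str N → F) := by
  classical
  let A : Matrix (Str N) (Str N) F := Matrix.of (klVec P X)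
  let B : Matrix (Lex (Str N)) (Lex (Str N)) F := A.submatrix ofLex ofLex
  have hB : B.det = 1 := by
    have ht : B.BlockTriangular OrderDual.toDual := by
      intro a b hab
      exact klCoeff_eq_zero P X (ofLex a) (ofLex b) hab
    rw [Matrix.det_of_isLowerTriangular (M := B) ht]
    exact Finset.prod_eq_one fun a _ => klCoeff_self P X (ofLex a)
  have hA : IsUnit A.det := by
    have h : B.det = A.det := Matrix.det_submatrix_equiv_self ofLex A
    rw [← h, hB]
    exact isUnit_one
  exact Matrix.linearIndependent_rows_of_isUnit ((Matrix.isUnit_iff_isUnit_det A).2 hA)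

/-- The Kazhdan–Lusztig basis `(C_ε)` of `V^{⊗ N}`. -/
def klBasis (P : Params F) (X : KLType) : Module.Basis (Str N) F (Str N → F) :=
  basisOfLinearIndependentOfCardEqFinrank' (klVec P X) (klVec_linearIndependent P X) (by simp)

theorem klBasis_apply (P : Params F) (X : KLType) (ε : Str N) :
    klBasis P X ε = klVec P X ε := by
  simp [klBasis]

/-! ### The Weyl group action and the operators `ê_1, …, ê_N` on functions -/

/-- The action of the simple reflection `s_i` on points `z = (z_1, …, z_N)`. -/
def sPoint (i : Fin N) (z : Fin N → F) : Fin N → F :=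
  if h : i.val + 1 < N then z ∘ Equiv.swap i ⟨i.val + 1, h⟩ else Function.update z i (z i)⁻¹

/-- A set of points on which the operators make sense: it is stable under the finite Weyl group and
at all its points the coordinates are non-zero and the denominators do not vanish. -/
structure IsRegularDomain (Ω : Set (Fin N → F)) : Prop where
  stable : ∀ i : Fin N, ∀ z ∈ Ω, sPoint i z ∈ Ω
  ne_zero : ∀ z ∈ Ω, ∀ i : Fin N, z i ≠ 0
  ne_succ : ∀ z ∈ Ω, ∀ (i : Fin N) (h : i.val + 1 < N), z i ≠ z ⟨i.val + 1, h⟩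
  sq_ne_one : ∀ z ∈ Ω, ∀ i : Fin N, i.val + 1 = N → z i ^ 2 ≠ 1

/-- The Hecke parameter of the generator with index `i`. -/
def heckeParam (P : Params F) (i : Fin N) : F := if i.val + 1 < N then P.q else P.qN

/-- The Demazure–Lusztig (Noumi) operators `T̂_1, …, T̂_N` on functions. -/
def hatT (P : Params F) (i : Fin N) (f : (Fin N → F) → F) : (Fin N → F) → F := fun z =>
  if h : i.val + 1 < N then
    -P.q * f z - P.q⁻¹ * ((1 - P.q ^ 2 * z i * (z ⟨i.val + 1, h⟩)⁻¹) /
      (1 - z i * (z ⟨i.val + 1, h⟩)⁻¹)) * (f (sPoint i z) - f z)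
  else
    -P.qN * f z - P.qN⁻¹ * ((1 + P.qN * P.ζN * z i) * (1 - P.qN * P.ζN⁻¹ * z i) /
      (1 - z i ^ 2)) * (f (sPoint i z) - f z)

/-- The operators `ê_i = T̂_i - q_i⁻¹`. -/
def hatE (P : Params F) (i : Fin N) (f : (Fin N → F) → F) : (Fin N → F) → F := fun z =>
  hatT P i f z - (heckeParam P i)⁻¹ * f z

/-- The component `Ψ_b` in `Ψ = ∑ b, Ψ_b C_b`. -/
def component (P : Params F) (X : KLType) (Ψ : (Fin N → F) → (Str N → F)) (b : Str N) :
    (Fin N → F) → F := fun z => (klBasis P X).repr (Ψ z) b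

/-- An operator `A` on functions acts on `Ψ` through the components: `AΨ = ∑ b, (A Ψ_b) C_b`. -/
def applyHat (P : Params F) (X : KLType) (A : ((Fin N → F) → F) → ((Fin N → F) → F))
    (Ψ : (Fin N → F) → (Str N → F)) : (Fin N → F) → (Str N → F) := fun z =>
  ∑ b : Str N, A (component P X Ψ b) z • klBasis P X b

/-- The non-affine part of the boundary qKZ equation: `e_i Ψ = ê_i Ψ` for `1 ≤ i ≤ N`. -/
def NonAffineQKZ (P : Params F) (X : KLType) (Ω : Set (Fin N → F))
    (Ψ : (Fin N → F) → (Str N → F)) : Prop :=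
  ∀ i : Fin N, ∀ z ∈ Ω, e P i (Ψ z) = applyHat P X (hatE P i) Ψ z

/-! ### The graph `Γ'` and its paths -/

/-- The action of the simple reflection `s_i` on binary strings. -/
def sStr (i : Fin N) (α : Str N) : Str N :=
  if h : i.val + 1 < N then α ∘ Equiv.swap i ⟨i.val + 1, h⟩
  else Function.update α i (if α i = plus then minus else plus)

/-- The vertices `α` and `β` of `Γ'` are connected by an edge which carries the integer `i`. -/
def Edge (i : Fin N) (α β : Str N) : Prop := α = sStr i β ∧ α ≠ β

/-- `IsPath a v l`: there is a path in `Γ'` from `a` to `v`, descending at each step, whose edges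
carry the integers `l = [i_1, …, i_l]` in this order. (The vertices of the path are determined by
`a` and `l`.) -/
inductive IsPath (a : Str N) : Str N → List (Fin N) → Prop
  | nil : IsPath a a []
  | step {v w : Str N} {l : List (Fin N)} {i : Fin N} :
      IsPath a v l → toLex w < toLex v → Edge i v w → IsPath a w (l ++ [i])

/-- `ê_{i_l} ⋯ ê_{i_1}` for the list `[i_1, …, i_l]`: the operator `ê_{i_1}` is applied first. -/
def hatEWord (P : Params F) (l : List (Fin N)) (f : (Fin N → F) → F) : (Fin N → F) → F :=
  l.foldl (fun g i => hatE P i g) f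

/-- `e_{i_1} ⋯ e_{i_l}` for the list `[i_1, …, i_l]`: the generator `e_{i_l}` is applied first. -/
def eWord (P : Params F) (l : List (Fin N)) (x : Str N → F) : Str N → F :=
  l.foldr (fun i y => e P i y) x

/-! ### The reduced set of equations -/

/-- The reduced set of equations has one equation for each `i`, `1 ≤ i ≤ N - 1`, and one for each
string `v < b₀`. -/
abbrev ReducedIndex (N : ℕ) : Type :=
  {i : Fin N // i.val + 1 < N} ⊕ {v : Str N // toLex v < toLex (b0 N)}

/-- The reduced set of equations for a choice `p` of paths: `ê_i Ψ_0 = 0`, and the path equations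
`e_{i_1} ⋯ e_{i_l} Ψ = ê_{i_l} ⋯ ê_{i_1} Ψ` at the basis vector `C_{b₀}`. -/
def ReducedEq (P : Params F) (X : KLType) (Ω : Set (Fin N → F))
    (Ψ : (Fin N → F) → (Str N → F)) (p : Str N → List (Fin N)) : ReducedIndex N → Prop
  | .inl i => ∀ z ∈ Ω, hatE P i.1 (component P X Ψ (b0 N)) z = 0
  | .inr v => ∀ z ∈ Ω, (klBasis P X).repr (eWord P (p v.1) (Ψ z)) (b0 N) =
      hatEWord P (p v.1) (component P X Ψ (b0 N)) z

/-- The same set of equations with the path equations in `V^{⊗ N}`, that is, at all basis vectors. -/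
def ReducedVecEq (P : Params F) (X : KLType) (Ω : Set (Fin N → F))
    (Ψ : (Fin N → F) → (Str N → F)) (p : Str N → List (Fin N)) : ReducedIndex N → Prop
  | .inl i => ∀ z ∈ Ω, hatE P i.1 (component P X Ψ (b0 N)) z = 0
  | .inr v => ∀ z ∈ Ω, eWord P (p v.1) (Ψ z) = applyHat P X (hatEWord P (p v.1)) Ψ z

end BoundaryQKZ

end

open BoundaryQKZ

open BoundaryQKZ

namespace BoundaryQKZ

/-! ### Parabolic modules of type B -/

/-! In the standard basis `e_i` links only the components at `ε` and `s_i ε`, so the equation at a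
string with an ascent or descent at `i` expresses one component through the other. Everything is
thus governed by `Ψ_0`, the component at `(- ⋯ -)`, which `e_1, …, e_{N-1}` require to be
annihilated by `ê_1, …, ê_{N-1}`.

Existence: such a `Ψ_0` always extends to a solution φ (`exists_isSolution`). The operators `ê_i +
q_i`, up to scalars, satisfy the braid relations of type B, and `Ψ_0` is a `q`-eigenvector of the
non-boundary ones. Applying to it the word that creates the up arrows of `ε` (`stringWord`) gives
the component at `ε`. The three lemmas `stringWord_zero`, `stringWord_swap` and `stringWord_eigen`
say that generators move these words as they move the basis vectors of a module induced from the
type A parabolic, and the quadratic relation gives the remaining cases.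

Uniqueness: a path equation is triangular at `b₀`. On vectors vanishing above `v`, the `b₀`
coefficient of `e_{i_1} ⋯ e_{i_l} x` is a non-zero multiple of `x v` (`IsPath.exists_eWord_b0`).
Since Ψ and φ have the same component at `b₀`, their path equations have the same right-hand sides,
and descending induction on `v` gives Ψ = φ (`isSolution_of_reduced`).

The Kazhdan–Lusztig basis matters little: operators acting through components are linear, hence
independent of the basis (`applyHat_apply`), and unitriangularity identifies the coefficients of
`C_{b₀}` and `v_{b₀}` (`klBasis_repr_b0`). -/

/-- The braid relations of type B, with the special generator `r 0`. -/
structure BraidRelationsB {A : Type*} [Monoid A] (r : ℕ → A) : Prop where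
  comm : ∀ i j, i + 2 ≤ j → r i * r j = r j * r i
  braid : ∀ i, r (i + 1) * r (i + 2) * r (i + 1) = r (i + 2) * r (i + 1) * r (i + 2)
  braid_zero : r 0 * r 1 * r 0 * r 1 = r 1 * r 0 * r 1 * r 0

section Words

variable {A : Type*} [Monoid A] {r : ℕ → A}

/-- The product `r k * ⋯ * r 1 * r 0`. -/
def descProd (r : ℕ → A) : ℕ → A
  | 0 => r 0
  | k + 1 => r (k + 1) * descProd r k

theorem BraidRelationsB.mul_descProd_comm (h : BraidRelationsB r) {i k : ℕ} (hik : k + 2 ≤ i) :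
    r i * descProd r k = descProd r k * r i := by
  induction k with
  | zero => exact (h.comm 0 i hik).symm
  | succ k ih =>
    rw [descProd, ← mul_assoc, ← h.comm (k + 1) i hik, mul_assoc, ih (by omega), mul_assoc]

/-- The generator commutes with the left factors until it meets `r (i + 2) * r (i + 1)`. There the
braid relation turns it into `r (i + 2)`, which commutes with the rest. -/
theorem BraidRelationsB.mul_descProd (h : BraidRelationsB r) {i k : ℕ} (hik : i + 1 < k) :
    r (i + 1) * descProd r k = descProd r k * r (i + 2) := by
  induction k with
  | zero => omega
  | succ k ih =>
    rcases Nat.lt_or_ge (i + 1) k with hlt | hge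
    · rw [descProd, ← mul_assoc, h.comm (i + 1) (k + 1) (by omega), mul_assoc, ih hlt, mul_assoc]
    · obtain rfl : k = i + 1 := by omega
      rw [descProd, descProd]
      calc r (i + 1) * (r (i + 2) * (r (i + 1) * descProd r i))
          = r (i + 1) * r (i + 2) * r (i + 1) * descProd r i := by simp only [mul_assoc]
        _ = r (i + 2) * r (i + 1) * (r (i + 2) * descProd r i) := by
          rw [h.braid]; simp only [mul_assoc]
        _ = _ := by rw [h.mul_descProd_comm le_rfl]; simp only [mul_assoc]

/-- The base case is the quartic relation, and the cubic relations propagate it. This identity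
handles two adjacent up arrows. -/
theorem BraidRelationsB.descProd_mul_self (h : BraidRelationsB r) (k : ℕ) :
    descProd r (k + 1) * descProd r (k + 1) = descProd r k * descProd r (k + 1) * r 1 := by
  induction k with
  | zero => simpa only [descProd, mul_assoc] using h.braid_zero.symm
  | succ k ih =>
    have hc := h.mul_descProd_comm (i := k + 2) (k := k) le_rfl
    calc descProd r (k + 2) * descProd r (k + 2)
        = r (k + 2) * r (k + 1) * (descProd r k * r (k + 2)) * descProd r (k + 1) := by
          simp only [descProd, mul_assoc]
      _ = (r (k + 2) * r (k + 1) * r (k + 2)) * descProd r k * descProd r (k + 1) := by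
          rw [← hc]; simp only [mul_assoc]
      _ = r (k + 1) * r (k + 2) * (descProd r (k + 1) * descProd r (k + 1)) := by
          rw [← h.braid]; simp only [descProd, mul_assoc]
      _ = r (k + 1) * (r (k + 2) * descProd r k) * descProd r (k + 1) * r 1 := by
          rw [ih]; simp only [mul_assoc]
      _ = _ := by rw [hc]; simp only [descProd, mul_assoc]

/-- The word which creates the up arrows of `ε` at the sites below `n`, the leftmost one first;
site `0` is the one next to the boundary. -/
def stringWord (r : ℕ → A) (ε : ℕ → Sgn) : ℕ → A
  | 0 => 1
  | n + 1 => stringWord r ε n * if ε n = Sgn.plus then descProd r n else 1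

theorem stringWord_congr {ε ε' : ℕ → Sgn} {n : ℕ} (h : ∀ k < n, ε k = ε' k) :
    stringWord r ε n = stringWord r ε' n := by
  induction n with
  | zero => rfl
  | succ n ih => rw [stringWord, stringWord, ih fun k hk => h k (by omega), h n (by omega)]

theorem BraidRelationsB.mul_stringWord_comm (h : BraidRelationsB r) (ε : ℕ → Sgn) {i n : ℕ}
    (hi : n + 1 ≤ i) : r i * stringWord r ε n = stringWord r ε n * r i := by
  induction n with
  | zero => simp [stringWord]
  | succ n ih =>
    rw [stringWord, ← mul_assoc, ih (by omega), mul_assoc, mul_assoc]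
    split_ifs with hp
    · rw [h.mul_descProd_comm (by omega)]
    · simp

end Words

/-! ### Words acting on a common eigenvector of the type A generators -/

section Module

variable {F M : Type*} [Field F] [AddCommGroup M] [Module F M] {r : ℕ → Module.End F M} {q : F}

/-- Moving past the product shifts the generator index by one, so only one eigenvalue condition is
lost. The inductions below can therefore absorb the letter farthest from the boundary into `g`. -/
theorem BraidRelationsB.descProd_apply_eigen (h : BraidRelationsB r) {n : ℕ} {g : M}
    (hg : ∀ k, 1 ≤ k → k < n + 1 → r k g = q • g) (k : ℕ) (h1 : 1 ≤ k) (hk : k < n) :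
    r k (descProd r n g) = q • descProd r n g := by
  obtain ⟨i, rfl⟩ : ∃ i, k = i + 1 := ⟨k - 1, by omega⟩
  rw [← Module.End.mul_apply, h.mul_descProd hk, Module.End.mul_apply, hg _ (by omega) (by omega),
    map_smul]

theorem BraidRelationsB.stringWord_zero (h : BraidRelationsB r) {n : ℕ} {g : M} (hn : 0 < n)
    (hg : ∀ k, 1 ≤ k → k < n → r k g = q • g) {ε ε' : ℕ → Sgn} (h0 : ε 0 = Sgn.minus)
    (h0' : ε' 0 = Sgn.plus) (hε : ∀ k, 1 ≤ k → ε k = ε' k) :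
    r 0 (stringWord r ε n g) = stringWord r ε' n g := by
  induction n generalizing g with
  | zero => omega
  | succ n ih =>
    rcases Nat.eq_zero_or_pos n with rfl | hpos
    · simp [stringWord, h0, h0', descProd]
    · rw [stringWord, stringWord, Module.End.mul_apply, Module.End.mul_apply, ← hε n hpos]
      apply ih hpos
      split_ifs
      · exact h.descProd_apply_eigen hg
      · exact fun k h1 hk => hg k h1 (by omega)

theorem BraidRelationsB.stringWord_eigen (h : BraidRelationsB r) {n i : ℕ} {g : M} (hn : i + 1 < n)
    (hg : ∀ k, 1 ≤ k → k < n → r k g = q • g) {ε : ℕ → Sgn} (hε : ε (i + 1) = ε i) :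
    r (i + 1) (stringWord r ε n g) = q • stringWord r ε n g := by
  induction n generalizing g with
  | zero => omega
  | succ n ih =>
    rcases Nat.lt_or_ge (i + 1) n with hlt | hge
    · rw [stringWord, Module.End.mul_apply]
      apply ih hlt
      split_ifs
      · exact h.descProd_apply_eigen hg
      · exact fun k h1 hk => hg k h1 (by omega)
    · obtain rfl : n = i + 1 := by omega
      rw [stringWord, stringWord, ← Module.End.mul_apply, ← mul_assoc, ← mul_assoc,
        h.mul_stringWord_comm ε le_rfl, hε]
      split_ifs
      -- Two up arrows: the generator completes the inner product to a square, and the square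
      -- formula leaves `r 1` acting on `g`.
      · rw [mul_assoc, mul_assoc, ← mul_assoc (r (i + 1)), ← descProd, h.descProd_mul_self]
        simp [hg 1 le_rfl (by omega)]
      · simp [hg (i + 1) (by omega) (by omega)]

/-- Moving an up arrow one site away from the boundary is the recursion that defines `descProd`. -/
theorem BraidRelationsB.stringWord_swap (h : BraidRelationsB r) {n i : ℕ} {g : M} (hn : i + 1 < n)
    (hg : ∀ k, 1 ≤ k → k < n → r k g = q • g) {ε ε' : ℕ → Sgn} (h1 : ε (i + 1) = Sgn.minus)
    (h0 : ε i = Sgn.plus) (h1' : ε' (i + 1) = Sgn.plus) (h0' : ε' i = Sgn.minus)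
    (hε : ∀ k, k ≠ i → k ≠ i + 1 → ε k = ε' k) :
    r (i + 1) (stringWord r ε n g) = stringWord r ε' n g := by
  induction n generalizing g with
  | zero => omega
  | succ n ih =>
    rcases Nat.lt_or_ge (i + 1) n with hlt | hge
    · rw [stringWord, stringWord, Module.End.mul_apply, Module.End.mul_apply,
        ← hε n (by omega) (by omega)]
      apply ih hlt
      split_ifs
      · exact h.descProd_apply_eigen hg
      · exact fun k h1 hk => hg k h1 (by omega)
    · obtain rfl : n = i + 1 := by omega
      have hc : stringWord r ε' i = stringWord r ε i :=
        stringWord_congr fun k hk => (hε k (by omega) (by omega)).symm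
      rw [stringWord, stringWord, stringWord, stringWord, hc, h0, h1, h0', h1',
        ← Module.End.mul_apply, ← mul_assoc, ← mul_assoc, h.mul_stringWord_comm ε le_rfl]
      simp [descProd]

end Module

/-! ### Demazure–Lusztig operators -/

section Operators

variable {X F : Type*} [Field F]

/-- The operator `1 + c (s - 1)` on functions. -/
def reflOp (c : X → F) (s : X → X) : Module.End F (X → F) where
  toFun f x := f x + c x * (f (s x) - f x)
  map_add' f g := by funext x; simp; ring
  map_smul' a f := by funext x; simp; ring

theorem reflOp_apply (c : X → F) (s : X → X) (f : X → F) (x : X) :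
    reflOp c s f x = f x + c x * (f (s x) - f x) := rfl

theorem reflOp_mul_self {c : X → F} {s : X → X} {t : F} (hs : ∀ x, s (s x) = x)
    (hc : ∀ x, c x + c (s x) = 1 + t) :
    reflOp c s * reflOp c s = (1 - t) • reflOp c s + t • 1 := by
  ext f x
  have h := hc x
  simp only [Module.End.mul_apply, reflOp_apply, LinearMap.add_apply, LinearMap.smul_apply,
    Pi.add_apply, Pi.smul_apply, smul_eq_mul, Module.End.one_apply, hs]
  linear_combination (-(c x) * (f (s x) - f x)) * h

theorem reflOp_comm {c d : X → F} {s t : X → X} (hst : ∀ x, s (t x) = t (s x))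
    (hc : ∀ x, c (t x) = c x) (hd : ∀ x, d (s x) = d x) :
    reflOp c s * reflOp d t = reflOp d t * reflOp c s := by
  ext f x
  simp only [Module.End.mul_apply, reflOp_apply, hst, hc, hd]
  ring

theorem reflOp_braid {s t : X → X} {u v w : X → F} {a : F} {c d : X → F}
    (hs : ∀ x, s (s x) = x) (ht : ∀ x, t (t x) = x) (hst : ∀ x, s (t (s x)) = t (s (t x)))
    (hus : ∀ x, u (s x) = v x) (hvs : ∀ x, v (s x) = u x) (hws : ∀ x, w (s x) = w x)
    (hut : ∀ x, u (t x) = u x) (hvt : ∀ x, v (t x) = w x) (hwt : ∀ x, w (t x) = v x)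
    (huv : ∀ x, v x - u x ≠ 0) (hvw : ∀ x, w x - v x ≠ 0) (huw : ∀ x, w x - u x ≠ 0)
    (hc : ∀ x, c x = (v x - a * u x) / (v x - u x))
    (hd : ∀ x, d x = (w x - a * v x) / (w x - v x)) :
    reflOp c s * reflOp d t * reflOp c s = reflOp d t * reflOp c s * reflOp d t := by
  ext f x
  simp only [Module.End.mul_apply, reflOp_apply, hc, hd, hus, hvs, hws, hut, hvt, hwt, hs, ht, hst]
  have h1 := huv x
  have h2 := hvw x
  have h3 := huw x
  have h1' : u x - v x ≠ 0 := by rwa [← neg_sub, neg_ne_zero]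
  have h2' : v x - w x ≠ 0 := by rwa [← neg_sub, neg_ne_zero]
  have h3' : u x - w x ≠ 0 := by rwa [← neg_sub, neg_ne_zero]
  field_simp
  ring

/-- Along the orbit `c` and `d` take only the values `c x`, `c (t x)`, `d x`, `d (s x)` and their
complements to `1 + a` and `1 + b * b'`. The relation reduces to one rational identity between these
four. -/
theorem reflOp_braid_boundary {s t : X → X} {u v : X → F} {a b b' : F} {c d : X → F}
    (hs : ∀ x, s (s x) = x) (ht : ∀ x, t (t x) = x)
    (hst : ∀ x, s (t (s (t x))) = t (s (t (s x))))
    (hus : ∀ x, u (s x) = v x) (hvs : ∀ x, v (s x) = u x)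
    (hut : ∀ x, u (t x) = u x) (hvt : ∀ x, v (t x) = (v x)⁻¹)
    (hu : ∀ x, u x ≠ 0) (hv : ∀ x, v x ≠ 0)
    (huv : ∀ x, v x - u x ≠ 0) (huv' : ∀ x, 1 - u x * v x ≠ 0)
    (hu2 : ∀ x, 1 - u x ^ 2 ≠ 0) (hv2 : ∀ x, 1 - v x ^ 2 ≠ 0)
    (hc : ∀ x, c x = (v x - a * u x) / (v x - u x))
    (hd : ∀ x, d x = (1 + b * v x) * (1 - b' * v x) / (1 - v x ^ 2)) :
    reflOp c s * reflOp d t * reflOp c s * reflOp d t =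
      reflOp d t * reflOp c s * reflOp d t * reflOp c s := by
  ext f x
  have h1 := huv x
  have h2 := huv' x
  have h3 := hu2 x
  have h4 := hv2 x
  have h5 := hu x
  have h6 := hv x
  have h1' : u x - v x ≠ 0 := by rw [← neg_sub, neg_ne_zero]; exact h1
  have h2' : u x * v x - 1 ≠ 0 := by rw [← neg_sub, neg_ne_zero]; exact h2
  have h3' : u x ^ 2 - 1 ≠ 0 := by rw [← neg_sub, neg_ne_zero]; exact h3
  have h4' : v x ^ 2 - 1 ≠ 0 := by rw [← neg_sub, neg_ne_zero]; exact h4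
  have e1 : (v x)⁻¹ - u x = (1 - u x * v x) / v x := by field_simp
  have e2 : (u x)⁻¹ - v x = (1 - u x * v x) / u x := by field_simp
  have e3 : u x - (v x)⁻¹ = (u x * v x - 1) / v x := by field_simp
  have e4 : (u x)⁻¹ - (v x)⁻¹ = (v x - u x) / (u x * v x) := by field_simp
  have e5 : 1 - (v x)⁻¹ ^ 2 = (v x ^ 2 - 1) / v x ^ 2 := by field_simp
  have e6 : 1 - (u x)⁻¹ ^ 2 = (u x ^ 2 - 1) / u x ^ 2 := by field_simp
  have cs : c (s x) = 1 + a - c x := by rw [hc, hc, hus, hvs]; field_simp; ring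
  have cts : c (t (s x)) = c (t x) := by
    rw [hc, hc, hut, hvt, hus, hvs, hut, hvt, e1, e2]; field_simp
  have cst : c (s (t x)) = 1 + a - c (t x) := by
    rw [hc, hc, hus, hvs, hut, hvt, e1, e3]; field_simp; ring
  have ctst : c (t (s (t x))) = c x := by
    rw [hc, hc, hut, hvt, hus, hvs, hut, hvt, e4]; field_simp
  have dt : d (t x) = 1 + b * b' - d x := by rw [hd, hd, hvt, e5]; field_simp; ring
  have dts : d (t (s x)) = 1 + b * b' - d (s x) := by
    rw [hd, hd, hvt, hvs, e6]; field_simp; ring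
  have dst : d (s (t x)) = d (s x) := by rw [hd, hd, hvs, hvs, hut]
  have dsts : d (s (t (s x))) = d x := by rw [hd, hd, hvs, hut, hus]
  -- The only place, after the orbit reductions, where the explicit form of `c` and `d` is used: the
  -- two sides of the braid relation differ by a multiple of this expression.
  have key : -(b * b' + a) + (1 + a) * d (s x) + (1 + b * b') * c (t x) - c (t x) * d (s x)
      - c (t x) * d x - c x * d (s x) + c x * d x = 0 := by
    rw [hd, hd, hc, hc, hvs, hut, hvt, e1]
    field_simp
    ring
  simp only [Module.End.mul_apply, reflOp_apply, hs, ht, hst, cs, cts, cst, ctst, dt, dts, dst,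
    dsts]
  generalize c x = A at *
  generalize c (t x) = B at *
  generalize d x = D at *
  generalize d (s x) = E at *
  linear_combination ((B * D - A * D) * f (t x) + (A * D - A * E) * f (s x)
    + A * E * f (t (s x)) - B * D * f (s (t x))) * key

end Operators

/-! ### Braid relations for the reflections of points -/

section Points

variable {F : Type*} [Field F] {N : ℕ}

theorem sPoint_self {i : Fin N} (h : i.val + 1 < N) (z : Fin N → F) :
    sPoint i z i = z ⟨i.val + 1, h⟩ := by
  simp [sPoint, h]

theorem sPoint_succ {i : Fin N} (h : i.val + 1 < N) (z : Fin N → F) :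
    sPoint i z ⟨i.val + 1, h⟩ = z i := by
  simp [sPoint, h]

theorem sPoint_last {i : Fin N} (h : ¬ i.val + 1 < N) (z : Fin N → F) :
    sPoint i z i = (z i)⁻¹ := by
  simp [sPoint, h]

theorem sPoint_of_ne {i k : Fin N} (z : Fin N → F) (h : k ≠ i) (h' : k.val ≠ i.val + 1) :
    sPoint i z k = z k := by
  unfold sPoint
  split_ifs with hi
  · rw [Function.comp_apply, Equiv.swap_apply_of_ne_of_ne h (fun e => h' (by rw [e]))]
  · rw [Function.update_of_ne h]

theorem sPoint_sPoint (i : Fin N) (z : Fin N → F) : sPoint i (sPoint i z) = z := by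
  funext k
  by_cases hk : k = i
  · subst hk
    by_cases h : k.val + 1 < N
    · rw [sPoint_self h, sPoint_succ h]
    · rw [sPoint_last h, sPoint_last h, inv_inv]
  · by_cases hk' : k.val = i.val + 1
    · have h : i.val + 1 < N := hk' ▸ k.2
      obtain rfl : k = ⟨i.val + 1, h⟩ := Fin.ext hk'
      rw [sPoint_succ h, sPoint_self h]
    · rw [sPoint_of_ne _ hk hk', sPoint_of_ne _ hk hk']

theorem sPoint_comm {i j : Fin N} (hij : i.val + 2 ≤ j.val) (z : Fin N → F) :
    sPoint i (sPoint j z) = sPoint j (sPoint i z) := by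
  have hi : i.val + 1 < N := by omega
  funext k
  simp only [sPoint, hi, dif_pos]
  split_ifs with hj
  · simp only [Function.comp_apply, Equiv.swap_apply_def]
    grind
  · simp only [Function.comp_apply, Equiv.swap_apply_def, Function.update_apply]
    grind

theorem sPoint_braid {i j : Fin N} (hij : j.val = i.val + 1) (hj : j.val + 1 < N) (z : Fin N → F) :
    sPoint i (sPoint j (sPoint i z)) = sPoint j (sPoint i (sPoint j z)) := by
  have hi : i.val + 1 < N := by omega
  funext k
  simp only [sPoint, hi, hj, dif_pos, Function.comp_apply, Equiv.swap_apply_def]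
  grind

theorem sPoint_braid_last {i j : Fin N} (hij : j.val = i.val + 1) (hj : ¬ j.val + 1 < N)
    (z : Fin N → F) :
    sPoint i (sPoint j (sPoint i (sPoint j z))) = sPoint j (sPoint i (sPoint j (sPoint i z))) := by
  have hi : i.val + 1 < N := by omega
  funext k
  simp only [sPoint, hi, hj, dif_pos, dif_neg, not_false_eq_true, Function.comp_apply,
    Equiv.swap_apply_def, Function.update_apply]
  grind

end Points

/-! ### The operators on functions restricted to a regular domain -/

section Domain

variable {F : Type*} [Field F] {N : ℕ} {Ω : Set (Fin N → F)}

/-- The reflections act on a regular domain. -/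
def IsRegularDomain.refl (hΩ : IsRegularDomain Ω) (i : Fin N) (z : Ω) : Ω :=
  ⟨sPoint i z, hΩ.stable i z z.2⟩

/-- The rational function `c` for which `T̂_i = -q_i - q_i⁻¹ c (s_i - 1)`. -/
def reflCoeff (P : Params F) (i : Fin N) (z : Fin N → F) : F :=
  if h : i.val + 1 < N then (z ⟨i.val + 1, h⟩ - P.q ^ 2 * z i) / (z ⟨i.val + 1, h⟩ - z i)
  else (1 + P.qN * P.ζN * z i) * (1 - P.qN * P.ζN⁻¹ * z i) / (1 - z i ^ 2)

/-- The operator `1 + c (s_i - 1)` on functions on a regular domain. -/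
def domainReflOp (P : Params F) (hΩ : IsRegularDomain Ω) (i : Fin N) : Module.End F (Ω → F) :=
  reflOp (fun z => reflCoeff P i z) (hΩ.refl i)

/-- The restriction of `ê_i` to functions on a regular domain. -/
def domainHatE (P : Params F) (hΩ : IsRegularDomain Ω) (i : Fin N) : Module.End F (Ω → F) :=
  -(heckeParam P i • 1 + (heckeParam P i)⁻¹ • domainReflOp P hΩ i)

theorem heckeParam_ne_zero (P : Params F) (i : Fin N) : heckeParam P i ≠ 0 := by
  unfold heckeParam
  split_ifs
  exacts [P.q_ne, P.qN_ne]

theorem reflCoeff_add (P : Params F) (hΩ : IsRegularDomain Ω) (i : Fin N) (z : Ω) :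
    reflCoeff P i z + reflCoeff P i (hΩ.refl i z) = 1 + heckeParam P i ^ 2 := by
  unfold reflCoeff heckeParam IsRegularDomain.refl
  dsimp only
  split_ifs with h
  · rw [sPoint_self h, sPoint_succ h]
    have h1 : z.1 ⟨i.val + 1, h⟩ - z.1 i ≠ 0 := sub_ne_zero.2 (hΩ.ne_succ z z.2 i h).symm
    have h2 : z.1 i - z.1 ⟨i.val + 1, h⟩ ≠ 0 := sub_ne_zero.2 (hΩ.ne_succ z z.2 i h)
    field_simp
    ring
  · rw [sPoint_last h]
    have h0 := hΩ.ne_zero z z.2 i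
    have h1 : 1 - z.1 i ^ 2 ≠ 0 := sub_ne_zero.2 (hΩ.sq_ne_one z z.2 i (by omega)).symm
    have h2 : z.1 i ^ 2 - 1 ≠ 0 := sub_ne_zero.2 (hΩ.sq_ne_one z z.2 i (by omega))
    have h3 : 1 - (z.1 i)⁻¹ ^ 2 = (z.1 i ^ 2 - 1) / z.1 i ^ 2 := by field_simp
    have := P.ζN_ne
    rw [h3]
    field_simp
    ring

theorem domainReflOp_mul_self (P : Params F) (hΩ : IsRegularDomain Ω) (i : Fin N) :
    domainReflOp P hΩ i * domainReflOp P hΩ i =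
      (1 - heckeParam P i ^ 2) • domainReflOp P hΩ i + heckeParam P i ^ 2 • 1 :=
  reflOp_mul_self (fun z => Subtype.ext (sPoint_sPoint i z.1)) (reflCoeff_add P hΩ i)

theorem domainHatE_apply (P : Params F) (hΩ : IsRegularDomain Ω) (i : Fin N) (f : Ω → F) :
    domainHatE P hΩ i f =
      -(heckeParam P i • f + (heckeParam P i)⁻¹ • domainReflOp P hΩ i f) := rfl

/-- The reflection operator satisfies a quadratic relation with eigenvalues `1` and `-q_i²`, on
which `ê_i` becomes `-(q_i + q_i⁻¹)` and `0`: the Temperley–Lieb relation. -/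
theorem domainHatE_domainHatE (P : Params F) (hΩ : IsRegularDomain Ω) (i : Fin N) (f : Ω → F) :
    domainHatE P hΩ i (domainHatE P hΩ i f) =
      -(heckeParam P i + (heckeParam P i)⁻¹) • domainHatE P hΩ i f := by
  have h := heckeParam_ne_zero P i
  have hsq : domainReflOp P hΩ i (domainReflOp P hΩ i f) =
      (1 - heckeParam P i ^ 2) • domainReflOp P hΩ i f + heckeParam P i ^ 2 • f :=
    LinearMap.congr_fun (domainReflOp_mul_self P hΩ i) f
  simp only [domainHatE_apply, map_neg, map_add, map_smul, hsq]
  match_scalars <;> field_simp <;> ring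

theorem reflCoeff_congr (P : Params F) {i : Fin N} {z w : Fin N → F} (h : z i = w i)
    (h' : ∀ hi : i.val + 1 < N, z ⟨i.val + 1, hi⟩ = w ⟨i.val + 1, hi⟩) :
    reflCoeff P i z = reflCoeff P i w := by
  unfold reflCoeff
  split_ifs with hi
  · rw [h, h' hi]
  · rw [h]

theorem domainReflOp_comm (P : Params F) (hΩ : IsRegularDomain Ω) {i j : Fin N}
    (hij : i.val + 2 ≤ j.val) :
    domainReflOp P hΩ i * domainReflOp P hΩ j = domainReflOp P hΩ j * domainReflOp P hΩ i := by
  refine reflOp_comm (fun z => Subtype.ext (sPoint_comm hij z.1)) (fun z => ?_) (fun z => ?_)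
  · exact reflCoeff_congr P (sPoint_of_ne _ (by simp [Fin.ext_iff]; omega) (by omega))
      fun hi => sPoint_of_ne _ (by simp [Fin.ext_iff]; omega) (by simp; omega)
  · exact reflCoeff_congr P (sPoint_of_ne _ (by simp [Fin.ext_iff]; omega) (by omega))
      fun hi => sPoint_of_ne _ (by simp [Fin.ext_iff]; omega) (by simp; omega)

theorem domainReflOp_braid (P : Params F) (hΩ : IsRegularDomain Ω) {i j : Fin N}
    (hij : j.val = i.val + 1) (hj : j.val + 1 < N) :
    domainReflOp P hΩ i * domainReflOp P hΩ j * domainReflOp P hΩ i =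
      domainReflOp P hΩ j * domainReflOp P hΩ i * domainReflOp P hΩ j := by
  have hi : i.val + 1 < N := by omega
  have hji : (⟨i.val + 1, hi⟩ : Fin N) = j := Fin.ext hij.symm
  -- Regularity separates neighbouring coordinates only; stability under `s_j` brings `z_{i+2}` next
  -- to `z_i`.
  have hne : ∀ z : Ω, z.1 i ≠ z.1 ⟨j.val + 1, hj⟩ := fun z => by
    have h := hΩ.ne_succ _ (hΩ.stable j z z.2) i hi
    rwa [hji, sPoint_self hj, sPoint_of_ne _ (by simp [Fin.ext_iff]; omega) (by omega)] at h
  refine reflOp_braid (u := fun z => z.1 i) (v := fun z => z.1 j)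
    (w := fun z => z.1 ⟨j.val + 1, hj⟩) (a := P.q ^ 2)
    (fun z => Subtype.ext (sPoint_sPoint i z.1)) (fun z => Subtype.ext (sPoint_sPoint j z.1))
    (fun z => Subtype.ext (sPoint_braid hij hj z.1)) ?_ ?_ ?_ ?_ ?_ ?_ ?_ ?_ ?_ ?_ ?_
  · intro z; simp only [IsRegularDomain.refl, sPoint_self hi, hji]
  · intro z; simp only [IsRegularDomain.refl, ← hji, sPoint_succ hi]
  · intro z; exact sPoint_of_ne _ (by simp [Fin.ext_iff]; omega) (by simp; omega)
  · intro z; exact sPoint_of_ne _ (by simp [Fin.ext_iff]; omega) (by omega)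
  · intro z; exact sPoint_self hj _
  · intro z; exact sPoint_succ hj _
  · intro z; rw [← hji]; exact sub_ne_zero.2 (hΩ.ne_succ z z.2 i hi).symm
  · intro z; exact sub_ne_zero.2 (hΩ.ne_succ z z.2 j hj).symm
  · intro z; exact sub_ne_zero.2 (hne z).symm
  · intro z; simp only [reflCoeff, hi, dif_pos, hji]
  · intro z; simp only [reflCoeff, hj, dif_pos]

theorem domainReflOp_braid_last (P : Params F) (hΩ : IsRegularDomain Ω) {i j : Fin N}
    (hij : j.val = i.val + 1) (hj : ¬ j.val + 1 < N) :
    domainReflOp P hΩ i * domainReflOp P hΩ j * domainReflOp P hΩ i * domainReflOp P hΩ j =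
      domainReflOp P hΩ j * domainReflOp P hΩ i * domainReflOp P hΩ j * domainReflOp P hΩ i := by
  have hi : i.val + 1 < N := by omega
  have hN : j.val + 1 = N := by omega
  have hji : (⟨i.val + 1, hi⟩ : Fin N) = j := Fin.ext hij.symm
  have hne : i ≠ j := by simp [Fin.ext_iff]; omega
  have hu : ∀ z : Fin N → F, sPoint j z i = z i := fun z => sPoint_of_ne _ hne (by omega)
  refine reflOp_braid_boundary (u := fun z => z.1 i) (v := fun z => z.1 j) (a := P.q ^ 2)
    (b := P.qN * P.ζN) (b' := P.qN * P.ζN⁻¹)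
    (fun z => Subtype.ext (sPoint_sPoint i z.1)) (fun z => Subtype.ext (sPoint_sPoint j z.1))
    (fun z => Subtype.ext (sPoint_braid_last hij hj z.1)) ?_ ?_ ?_ ?_ ?_ ?_ ?_ ?_ ?_ ?_ ?_ ?_
  · intro z; simp only [IsRegularDomain.refl, sPoint_self hi, hji]
  · intro z; simp only [IsRegularDomain.refl, ← hji, sPoint_succ hi]
  · intro z; exact hu _
  · intro z; exact sPoint_last hj _
  · intro z; exact hΩ.ne_zero z z.2 i
  · intro z; exact hΩ.ne_zero z z.2 j
  · intro z; rw [← hji]; exact sub_ne_zero.2 (hΩ.ne_succ z z.2 i hi).symm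
  · intro z
    -- Regularity at `s_N z` says that `z_{N-1} ≠ z_N⁻¹`.
    have h := hΩ.ne_succ _ (hΩ.stable j z z.2) i hi
    rw [hji, hu, sPoint_last hj] at h
    have h0 := hΩ.ne_zero z z.2 j
    exact sub_ne_zero.2 fun e => h (eq_inv_of_mul_eq_one_left e.symm)
  · intro z
    have h := hΩ.sq_ne_one _ (hΩ.stable i z z.2) j hN
    rw [← hji, sPoint_succ hi] at h
    exact sub_ne_zero.2 h.symm
  · intro z; exact sub_ne_zero.2 (hΩ.sq_ne_one z z.2 j hN).symm
  · intro z; simp only [reflCoeff, hi, dif_pos, hji]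
  · intro z; simp only [reflCoeff, hj, dif_neg, not_false_eq_true]

end Domain

open Sgn

/-! ### The generators in the standard basis -/

section Standard

variable {F : Type*} [Field F] {N : ℕ}

theorem sStr_self {i : Fin N} (h : i.val + 1 < N) (α : Str N) :
    sStr i α i = α ⟨i.val + 1, h⟩ := by
  simp [sStr, h]

theorem sStr_succ {i : Fin N} (h : i.val + 1 < N) (α : Str N) :
    sStr i α ⟨i.val + 1, h⟩ = α i := by
  simp [sStr, h]

theorem sStr_last {i : Fin N} (h : ¬ i.val + 1 < N) (α : Str N) :
    sStr i α i = if α i = plus then minus else plus := by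
  simp [sStr, h]

theorem sStr_of_ne {i k : Fin N} (α : Str N) (h : k ≠ i) (h' : k.val ≠ i.val + 1) :
    sStr i α k = α k := by
  unfold sStr
  split_ifs with hi
  · rw [Function.comp_apply, Equiv.swap_apply_of_ne_of_ne h (fun e => h' (by rw [e]))]
  all_goals rw [Function.update_of_ne h]

theorem sStr_eq_self {i : Fin N} (h : i.val + 1 < N) {α : Str N}
    (he : α i = α ⟨i.val + 1, h⟩) : sStr i α = α := by
  funext k
  simp only [sStr, h, dif_pos, Function.comp_apply, Equiv.swap_apply_def]
  split_ifs with h1 h2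
  · rw [h1, he]
  · rw [h2, he]
  · rfl

theorem sStr_sStr (i : Fin N) (α : Str N) : sStr i (sStr i α) = α := by
  funext k
  by_cases hk : k = i
  · subst hk
    by_cases h : k.val + 1 < N
    · rw [sStr_self h, sStr_succ h]
    · rw [sStr_last h, sStr_last h]
      cases α k <;> simp
  · by_cases hk' : k.val = i.val + 1
    · have h : i.val + 1 < N := hk' ▸ k.2
      obtain rfl : k = ⟨i.val + 1, h⟩ := Fin.ext hk'
      rw [sStr_succ h, sStr_self h]
    · rw [sStr_of_ne _ hk hk', sStr_of_ne _ hk hk']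

/-- The diagonal entries of `e_i` in the basis `(v_ε)`. -/
def eDiag (P : Params F) (i : Fin N) (α : Str N) : F :=
  if h : i.val + 1 < N then bulkEntry P (α i) (α ⟨i.val + 1, h⟩) (α i) (α ⟨i.val + 1, h⟩)
  else bdryEntry P (α i) (α i)

/-- The entries of `e_i` between `v_α` and `v_{s_i α}`, and `0` if `s_i α = α`. -/
def eOff (P : Params F) (i : Fin N) (α : Str N) : F :=
  if h : i.val + 1 < N then
    if α i = α ⟨i.val + 1, h⟩ then 0 else 1
  else bdryEntry P (α i) (sStr i α i)

/-- Each row of either local matrix has at most one non-zero off-diagonal entry, in the column of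
the reflected letters. -/
theorem e_apply (P : Params F) (i : Fin N) (x : Str N → F) (α : Str N) :
    e P i x α = eDiag P i α * x α + eOff P i α * x (sStr i α) := by
  have hsum : ∀ f : Sgn → F, ∑ c, f c = f plus + f minus := fun f => by
    simp [Finset.univ, Fintype.elems]
  have hu : ∀ (β : Str N) (k : Fin N) (c : Sgn), Function.update β k c k = c :=
    fun β k c => Function.update_self k c β
  by_cases h : i.val + 1 < N
  · have hne : (⟨i.val + 1, h⟩ : Fin N) ≠ i := by simp [Fin.ext_iff]
    have key : ∀ c d : Sgn, ∀ β : Str N, β i = c → β ⟨i.val + 1, h⟩ = d →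
        (∀ k : Fin N, k ≠ i → k.val ≠ i.val + 1 → β k = α k) →
        Function.update (Function.update α i c) ⟨i.val + 1, h⟩ d = β := by
      intro c d β h1 h2 h3
      funext k
      by_cases hk : k = ⟨i.val + 1, h⟩
      · subst hk; rw [Function.update_self, h2]
      · rw [Function.update_of_ne hk]
        by_cases hk' : k = i
        · subst hk'; rw [Function.update_self, h1]
        · rw [Function.update_of_ne hk', h3 k hk' (by simpa [Fin.ext_iff] using hk)]
    simp only [e, LinearMap.coe_mk, AddHom.coe_mk, dif_pos h, eDiag, eOff, hsum]
    rcases ha : α i <;> rcases hb : α ⟨i.val + 1, h⟩ <;>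
      simp only [bulkEntry, zero_mul, add_zero, zero_add, if_true, reduceCtorEq, if_false]
    · rw [key plus minus α ha hb fun _ _ _ => rfl, key minus plus (sStr i α)
        (by rw [sStr_self h, hb]) (by rw [sStr_succ h, ha]) fun k => sStr_of_ne _]
    · rw [key minus plus α ha hb fun _ _ _ => rfl, key plus minus (sStr i α)
        (by rw [sStr_self h, hb]) (by rw [sStr_succ h, ha]) fun k => sStr_of_ne _]
      ring
  · have key : ∀ c : Sgn, ∀ β : Str N, β i = c → (∀ k : Fin N, k ≠ i → β k = α k) →
        Function.update α i c = β := by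
      intro c β h1 h3
      funext k
      by_cases hk' : k = i
      · subst hk'; rw [Function.update_self, h1]
      · rw [Function.update_of_ne hk', h3 k hk']
    have hs := sStr_last h α
    have hk : ∀ k : Fin N, k ≠ i → sStr i α k = α k :=
      fun k hk => sStr_of_ne _ hk (by omega)
    simp only [e, LinearMap.coe_mk, AddHom.coe_mk, dif_neg h, eDiag, eOff, hsum]
    rcases ha : α i <;> simp only [ha, if_true, reduceCtorEq, if_false] at hs
    · rw [hs, key plus α ha fun _ _ => rfl, key minus _ hs hk]
    · rw [hs, key minus α ha fun _ _ => rfl, key plus _ hs hk, add_comm]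

theorem eOff_ne_zero (P : Params F) {i : Fin N} {α : Str N} (h : sStr i α ≠ α) :
    eOff P i α ≠ 0 := by
  unfold eOff
  split_ifs with hi he
  · exact absurd (sStr_eq_self hi he) h
  · exact one_ne_zero
  · rw [sStr_last hi]
    cases α i <;> simp [bdryEntry, P.κN_ne]

end Standard

/-! ### The equations on a regular domain -/

section Solutions

variable {F : Type*} [Field F] {N : ℕ} {Ω : Set (Fin N → F)}

/-- The non-affine part of the boundary qKZ equation for the components in the basis `(v_ε)`,
as functions on `Ω`. -/
def IsSolution (P : Params F) (hΩ : IsRegularDomain Ω) (ψ : Str N → Ω → F) : Prop :=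
  ∀ i α, domainHatE P hΩ i (ψ α) = eDiag P i α • ψ α + eOff P i α • ψ (sStr i α)

/-- The reflection operators, numbered from the boundary, with the normalisation in which they
permute the components of a solution. -/
def scaledReflOp (P : Params F) (hΩ : IsRegularDomain Ω) (k : ℕ) : Module.End F (Ω → F) :=
  if h : k < N then
    (if k = 0 then -(P.κN * P.qN⁻¹) else -P.q⁻¹) • domainReflOp P hΩ ⟨N - 1 - k, by omega⟩
  else 0

theorem braidRelationsB_scaledReflOp (P : Params F) (hΩ : IsRegularDomain Ω) :
    BraidRelationsB (scaledReflOp P hΩ) where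
  comm i j hij := by
    unfold scaledReflOp
    by_cases hj : j < N
    · have hi : i < N := by omega
      rw [dif_pos hi, dif_pos hj, smul_mul_smul_comm, smul_mul_smul_comm,
        domainReflOp_comm P hΩ (i := ⟨N - 1 - j, by omega⟩) (j := ⟨N - 1 - i, by omega⟩)
          (by simp only; omega), mul_comm]
    · rw [dif_neg hj, mul_zero, zero_mul]
  braid i := by
    unfold scaledReflOp
    by_cases hj : i + 2 < N
    · have hi : i + 1 < N := by omega
      rw [dif_pos hi, dif_pos hj, if_neg (by omega), if_neg (by omega)]
      simp only [smul_mul_smul_comm]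
      rw [domainReflOp_braid P hΩ (i := ⟨N - 1 - (i + 2), by omega⟩)
          (j := ⟨N - 1 - (i + 1), by omega⟩) (by simp only; omega) (by simp only; omega)]
    · rw [dif_neg hj, mul_zero, zero_mul, zero_mul]
  braid_zero := by
    unfold scaledReflOp
    by_cases hj : 1 < N
    · have hi : 0 < N := by omega
      rw [dif_pos hi, dif_pos hj, if_pos rfl, if_neg one_ne_zero]
      simp only [smul_mul_smul_comm]
      rw [domainReflOp_braid_last P hΩ (i := ⟨N - 1 - 1, by omega⟩)
          (j := ⟨N - 1 - 0, by omega⟩) (by simp only; omega) (by simp only; omega)]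
      -- Each generator occurs twice on either side, so `r 0` and `r 1` may be scaled independently.
      congr 1
      ring
    · rw [dif_neg hj, mul_zero, zero_mul, zero_mul, zero_mul]

/-- A string as a function of the distance to the boundary. -/
def revString (α : Str N) (k : ℕ) : Sgn := if h : k < N then α ⟨N - 1 - k, by omega⟩ else minus

theorem revString_sub (α : Str N) (i : Fin N) : revString α (N - 1 - i.val) = α i := by
  rw [revString, dif_pos (by omega)]
  congr 1
  ext
  simp only
  omega

/-- The second condition excludes the other site of a swap. Its additive form is automatic for the
last site, where truncated subtraction would exclude a wrong position. -/
theorem revString_sStr {i : Fin N} (α : Str N) {k : ℕ} (h : k ≠ N - 1 - i.val)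
    (h' : k + 2 + i.val ≠ N) : revString (sStr i α) k = revString α k := by
  unfold revString
  split_ifs with hk
  · exact sStr_of_ne _ (by simp only [ne_eq, Fin.ext_iff]; omega) (by simp only; omega)
  · rfl

theorem scaledReflOp_of_pos (P : Params F) (hΩ : IsRegularDomain Ω) {i : Fin N}
    (h : i.val + 1 < N) (f : Ω → F) :
    scaledReflOp P hΩ (N - 1 - i.val) f = domainHatE P hΩ i f + P.q • f := by
  have hi : (⟨N - 1 - (N - 1 - i.val), by omega⟩ : Fin N) = i := by ext; simp only; omega
  rw [scaledReflOp, dif_pos (by omega), if_neg (by omega), hi, domainHatE_apply, heckeParam,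
    if_pos h, LinearMap.smul_apply]
  module

theorem scaledReflOp_last (P : Params F) (hΩ : IsRegularDomain Ω) {i : Fin N}
    (h : ¬ i.val + 1 < N) (f : Ω → F) :
    scaledReflOp P hΩ 0 f = P.κN • (domainHatE P hΩ i f + P.qN • f) := by
  have hi : (⟨N - 1 - 0, by omega⟩ : Fin N) = i := by ext; simp only; omega
  rw [scaledReflOp, dif_pos (by omega), if_pos rfl, hi, domainHatE_apply, heckeParam,
    if_neg h, LinearMap.smul_apply]
  module

/-- A function annihilated by `ê_1, …, ê_{N-1}` extends to a solution. -/
theorem exists_isSolution (P : Params F) (hΩ : IsRegularDomain Ω) {g : Ω → F}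
    (hg : ∀ i : Fin N, i.val + 1 < N → domainHatE P hΩ i g = 0) :
    ∃ φ : Str N → Ω → F, IsSolution P hΩ φ ∧ φ (b0 N) = g := by
  have hB := braidRelationsB_scaledReflOp P hΩ
  -- The scaled operator is `ê_i + q`, so being annihilated by `ê_i` means having eigenvalue `q`.
  have hg' : ∀ k, 1 ≤ k → k < N → scaledReflOp P hΩ k g = P.q • g := by
    intro k h1 hk
    have h := scaledReflOp_of_pos P hΩ (i := ⟨N - 1 - k, by omega⟩) (by simp only; omega) g
    rw [hg _ (by simp only; omega), zero_add] at h
    simpa only [show N - 1 - (N - 1 - k) = k by omega] using h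
  refine ⟨fun α => stringWord (scaledReflOp P hΩ) (revString α) N g, ?_, ?_⟩
  · intro i α
    have hq := P.q_ne
    have hqN := P.qN_ne
    have hκ := P.κN_ne
    have hrev := revString_sub α i
    have hrevs := revString_sub (sStr i α) i
    by_cases h : i.val + 1 < N
    · obtain ⟨k, hk⟩ : ∃ k, N - 1 - i.val = k + 1 := ⟨N - 1 - i.val - 1, by omega⟩
      have hk' : N - 1 - (i.val + 1) = k := by omega
      have hsucc := revString_sub α ⟨i.val + 1, h⟩
      have hsuccs := revString_sub (sStr i α) ⟨i.val + 1, h⟩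
      have hS := scaledReflOp_of_pos P hΩ h
      simp only [hk, hk', sStr_self h, sStr_succ h] at hrev hrevs hsucc hsuccs hS
      have hoff : ∀ m, m ≠ k → m ≠ k + 1 → revString (sStr i α) m = revString α m :=
        fun m h1 h2 => revString_sStr α (by omega) (by omega)
      unfold eDiag eOff
      rw [dif_pos h, dif_pos h]
      rcases ha : α i <;> rcases hb : α ⟨i.val + 1, h⟩ <;>
        simp only [bulkEntry, if_true, reduceCtorEq, if_false]
      · have := hB.stringWord_eigen (n := N) (i := k) (by omega) hg' (ε := revString α)
          (by rw [hrev, hsucc, ha, hb])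
        rw [hS] at this
        simpa using this
      -- Here the component at `α` is `ê_i + q` applied to the one at `s_i α`, and the equation
      -- follows from the quadratic relation. In the case `-+` it is just the swap rule.
      · have := hB.stringWord_swap (n := N) (i := k) (by omega) hg' (ε := revString (sStr i α))
          (ε' := revString α) (by rw [hrevs, hb]) (by rw [hsuccs, ha]) (by rw [hrev, ha])
          (by rw [hsucc, hb]) hoff
        rw [hS] at this
        rw [← this, map_add, domainHatE_domainHatE, map_smul, heckeParam, if_pos h]
        match_scalars <;> field_simp <;> ring
      · have := hB.stringWord_swap (n := N) (i := k) (by omega) hg' (ε := revString α)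
          (ε' := revString (sStr i α)) (by rw [hrev, ha]) (by rw [hsucc, hb]) (by rw [hrevs, hb])
          (by rw [hsuccs, ha]) fun m h1 h2 => (hoff m h1 h2).symm
        rw [hS] at this
        rw [← this]
        module
      · have := hB.stringWord_eigen (n := N) (i := k) (by omega) hg' (ε := revString α)
          (by rw [hrev, hsucc, ha, hb])
        rw [hS] at this
        simpa using this
    · have h0 : N - 1 - i.val = 0 := by omega
      rw [h0] at hrev hrevs
      rw [sStr_last h] at hrevs
      have hS := scaledReflOp_last P hΩ h
      have hoff : ∀ m, 1 ≤ m → revString (sStr i α) m = revString α m :=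
        fun m h1 => revString_sStr α (by omega) (by omega)
      unfold eDiag eOff
      rw [dif_neg h, dif_neg h, sStr_last h]
      rcases ha : α i <;> simp only [bdryEntry, if_true, reduceCtorEq, if_false]
      -- As for `+-`: the component with last letter `+` is an image under `ê_N + q_N`, up to `κ_N`.
      · have := hB.stringWord_zero (n := N) (by omega) hg' (ε := revString (sStr i α))
          (ε' := revString α) (by simp [hrevs, ha]) (by rw [hrev, ha]) hoff
        rw [hS] at this
        rw [← this, map_smul, map_add, domainHatE_domainHatE, map_smul, heckeParam, if_neg h]
        match_scalars <;> field_simp <;> ring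
      · have := hB.stringWord_zero (n := N) (by omega) hg' (ε := revString α)
          (ε' := revString (sStr i α)) (by rw [hrev, ha]) (by simp [hrevs, ha])
          fun m h1 => (hoff m h1).symm
        rw [hS] at this
        rw [← this]
        match_scalars <;> field_simp <;> ring
  · have : ∀ n, stringWord (scaledReflOp P hΩ) (revString (b0 N)) n = 1 := by
      intro n
      induction n with
      | zero => rfl
      | succ n ih => rw [stringWord, ih]; simp [revString, b0]
    simp only [this, Module.End.one_apply]

end Solutions

open Sgn

/-! ### Paths -/

section Paths

variable {N : ℕ}

theorem Sgn.lt_iff {a b : Sgn} : a < b ↔ a = plus ∧ b = minus := by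
  revert a b
  decide

theorem toLex_lt_iff {α β : Str N} :
    toLex α < toLex β ↔ ∃ k, (∀ j < k, α j = β j) ∧ α k = plus ∧ β k = minus := by
  simp only [← Sgn.lt_iff]
  rfl

theorem lt_b0_iff {α : Str N} : toLex α < toLex (b0 N) ↔ α ≠ b0 N := by
  refine ⟨fun h e => lt_irrefl _ (e ▸ h), fun h => ?_⟩
  refine lt_of_le_of_ne (not_lt.1 fun hlt => ?_) fun e => h (toLex.injective e)
  obtain ⟨k, -, hk, -⟩ := toLex_lt_iff.1 hlt
  cases hk

theorem minus_of_sStr_lt {i : Fin N} {α : Str N} (h : toLex (sStr i α) < toLex α) :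
    α i = minus ∧ ∀ hi : i.val + 1 < N, α ⟨i.val + 1, hi⟩ = plus := by
  obtain ⟨k, hlt, h1, h2⟩ := toLex_lt_iff.1 h
  have hk : k = i ∨ k.val = i.val + 1 := by
    by_contra! hne
    rw [sStr_of_ne α hne.1 hne.2, h2] at h1
    cases h1
  rcases hk with rfl | hk
  · exact ⟨h2, fun hi => by rw [← sStr_self hi α, h1]⟩
  · have hi : i.val + 1 < N := hk ▸ k.2
    obtain rfl : k = ⟨i.val + 1, hi⟩ := Fin.ext hk
    have := hlt i (by simp [Fin.lt_def])
    rw [sStr_self hi, h2] at this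
    rw [sStr_succ hi, ← this] at h1
    cases h1

/-- A reflection which lowers `α` does not carry larger strings below the image of `α`. -/
theorem sStr_lt_sStr {i : Fin N} {α β : Str N} (h : toLex (sStr i α) < toLex α)
    (hαβ : toLex α < toLex β) : toLex (sStr i α) < toLex (sStr i β) := by
  obtain ⟨hm, hp⟩ := minus_of_sStr_lt h
  obtain ⟨k, hlt, h1, h2⟩ := toLex_lt_iff.1 hαβ
  have hki : k ≠ i := by
    rintro rfl
    rw [hm] at h1
    cases h1
  by_cases hk : k.val = i.val + 1
  · have hi : i.val + 1 < N := hk ▸ k.2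
    obtain rfl : k = ⟨i.val + 1, hi⟩ := Fin.ext hk
    -- Before site `i + 1` the strings agree, so `β` has `-` at both sites and is fixed.
    have hβ : sStr i β = β := sStr_eq_self hi (by
      rw [h2, ← hlt i (by simp [Fin.lt_def]), hm])
    rw [hβ]
    exact h.trans hαβ
  refine toLex_lt_iff.2 ⟨k, fun j hj => ?_, by rwa [sStr_of_ne _ hki hk],
    by rwa [sStr_of_ne _ hki hk]⟩
  by_cases hi : i.val + 1 < N
  · by_cases hji : j = i
    · subst hji
      rw [sStr_self hi, sStr_self hi]
      exact hlt _ (by rw [Fin.lt_def] at *; simp only; omega)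
    · by_cases hji' : j.val = i.val + 1
      · obtain rfl : j = ⟨i.val + 1, hi⟩ := Fin.ext hji'
        rw [sStr_succ hi, sStr_succ hi]
        exact hlt _ (by rw [Fin.lt_def] at *; simp only at hj; omega)
      · rw [sStr_of_ne _ hji hji', sStr_of_ne _ hji hji']
        exact hlt j hj
  · have hji : j ≠ i := by rw [Fin.lt_def] at hj; rw [ne_eq, Fin.ext_iff]; omega
    rw [sStr_of_ne _ hji (by omega), sStr_of_ne _ hji (by omega)]
    exact hlt j hj

/-- The rightmost up arrow can be raised: either a down arrow follows it, or it is the last letter.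
-/
theorem exists_edge_of_ne_b0 {α : Str N} (h : α ≠ b0 N) :
    ∃ i, toLex α < toLex (sStr i α) := by
  classical
  have hne : (Finset.univ.filter fun k => α k = plus).Nonempty := by
    by_contra hn
    rw [Finset.not_nonempty_iff_eq_empty, Finset.filter_eq_empty_iff] at hn
    refine h (funext fun k => ?_)
    have := hn (Finset.mem_univ k)
    rcases hk : α k
    · exact absurd hk this
    · rfl
  obtain ⟨i, hi, hmax⟩ := Finset.exists_max_image _ id hne
  rw [Finset.mem_filter] at hi
  refine ⟨i, toLex_lt_iff.2 ⟨i, fun j hj => (sStr_of_ne _ hj.ne ?_).symm, hi.2, ?_⟩⟩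
  · rw [Fin.lt_def] at hj
    omega
  · by_cases h' : i.val + 1 < N
    · rw [sStr_self h']
      rcases hk : α ⟨i.val + 1, h'⟩
      · have := hmax ⟨i.val + 1, h'⟩ (by simp [hk])
        simp [Fin.le_def] at this
      · rfl
    · rw [sStr_last h', if_pos hi.2]

theorem exists_isPath (α : Str N) : ∃ l, IsPath (b0 N) α l := by
  suffices ∀ a : Lex (Str N), ∃ l, IsPath (b0 N) (ofLex a) l from this (toLex α)
  intro a
  induction a using (wellFounded_gt (α := Lex (Str N))).induction with
  | _ a ih =>
    by_cases h : ofLex a = b0 N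
    · exact ⟨[], h ▸ .nil⟩
    · obtain ⟨i, hi⟩ := exists_edge_of_ne_b0 h
      obtain ⟨l, hl⟩ := ih (toLex (sStr i (ofLex a))) hi
      exact ⟨l ++ [i], hl.step hi ⟨rfl, fun e => lt_irrefl _ (e ▸ hi)⟩⟩

theorem card_reducedIndex (hN : 1 ≤ N) : Nat.card (ReducedIndex N) = 2 ^ N + N - 2 := by
  classical
  have hpow : 1 ≤ 2 ^ N := Nat.one_le_two_pow
  have hS : Fintype.card Sgn = 2 := rfl
  have h1 : Fintype.card {i : Fin N // i.val + 1 < N} = N - 1 := by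
    have h : Fintype.card {i : Fin N // i.val + 1 = N} = 1 :=
      Fintype.card_eq_one_iff.2 ⟨⟨⟨N - 1, by omega⟩, by simp only; omega⟩, fun x =>
        Subtype.ext (Fin.ext (by have := x.2; simp only; omega))⟩
    have hc := Fintype.card_subtype_compl fun i : Fin N => i.val + 1 = N
    rw [h, Fintype.card_fin] at hc
    rw [← hc]
    exact Fintype.card_congr (Equiv.subtypeEquivRight fun i => by have := i.2; omega)
  have h2 : Fintype.card {v : Str N // toLex v < toLex (b0 N)} = 2 ^ N - 1 := by
    have hc := Fintype.card_subtype_compl fun v : Str N => v = b0 N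
    rw [Fintype.card_subtype_eq, Fintype.card_fun, Fintype.card_fin, hS] at hc
    rw [← hc]
    exact Fintype.card_congr (Equiv.subtypeEquivRight fun v => lt_b0_iff)
  rw [Nat.card_sum, Nat.card_eq_fintype_card, Nat.card_eq_fintype_card, h1, h2]
  omega

variable {F : Type*} [Field F]

theorem eWord_append (P : Params F) (l : List (Fin N)) (i : Fin N) (x : Str N → F) :
    eWord P (l ++ [i]) x = eWord P l (e P i x) := by
  simp [eWord]

theorem eWord_sub (P : Params F) (l : List (Fin N)) (x y : Str N → F) :
    eWord P l (x - y) = eWord P l x - eWord P l y := by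
  induction l with
  | nil => rfl
  | cons i l ih => exact (congrArg (e P i) ih).trans (map_sub _ _ _)

/-- The path equation of `v` at `b₀` is triangular, with a non-zero diagonal entry. -/
theorem IsPath.exists_eWord_b0 (P : Params F) {v : Str N} {l : List (Fin N)}
    (h : IsPath (b0 N) v l) :
    ∃ c : F, c ≠ 0 ∧ ∀ x : Str N → F, (∀ u, toLex v < toLex u → x u = 0) →
      eWord P l x (b0 N) = c * x v := by
  induction h with
  | nil => exact ⟨1, one_ne_zero, fun x _ => (one_mul _).symm⟩
  | @step v w l i _ hlt hedge ih =>
    obtain ⟨c, hc, ih⟩ := ih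
    obtain ⟨rfl, hne⟩ := hedge
    have hw : sStr i (sStr i w) = w := sStr_sStr i w
    have hlt' : toLex (sStr i (sStr i w)) < toLex (sStr i w) := by rwa [hw]
    refine ⟨c * eOff P i (sStr i w), mul_ne_zero hc (eOff_ne_zero P (by rw [hw]; exact hne.symm)),
      fun x hx => ?_⟩
    rw [eWord_append, ih, e_apply, hw, hx _ hlt]
    · ring
    -- Above `s_i w`, both entries that contribute to `e_i x` lie above `w`: `u` itself, and `s_i u`
    -- by `sStr_lt_sStr`.
    · intro u hu
      have h1 := sStr_lt_sStr hlt' hu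
      rw [hw] at h1
      rw [e_apply, hx u (hlt.trans hu), hx _ h1, mul_zero, mul_zero, add_zero]

end Paths

/-! ### Components -/

section Components

variable {F : Type*} [Field F] {N : ℕ} {Ω : Set (Fin N → F)}

/-- By unitriangularity no other `C_b` contains `v_{b₀}`, as `b₀` is the largest string. -/
theorem klBasis_repr_b0 (P : Params F) (X : KLType) (x : Str N → F) :
    (klBasis P X).repr x (b0 N) = x (b0 N) := by
  have h := congrFun ((klBasis P X).sum_repr x) (b0 N)
  rw [Finset.sum_apply, Finset.sum_eq_single (b0 N)] at h
  · rw [← h, Pi.smul_apply, klBasis_apply, klVec, klCoeff_self, smul_eq_mul, mul_one]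
  · intro b _ hb
    rw [Pi.smul_apply, klBasis_apply, klVec, klCoeff_eq_zero P X _ _ (lt_b0_iff.2 hb), smul_zero]
  · exact fun hn => absurd (Finset.mem_univ _) hn

theorem isLinearMap_hatE (P : Params F) (i : Fin N) : IsLinearMap F (hatE P i) where
  map_add f g := by
    funext z
    simp only [hatE, hatT, Pi.add_apply]
    split_ifs <;> ring
  map_smul a f := by
    funext z
    simp only [hatE, hatT, Pi.smul_apply, smul_eq_mul]
    split_ifs <;> ring

theorem isLinearMap_hatEWord (P : Params F) (l : List (Fin N)) :
    IsLinearMap F (hatEWord P l) := by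
  induction l with
  | nil => exact ⟨fun _ _ => rfl, fun _ _ => rfl⟩
  | cons i l ih =>
    exact ((ih.mk' _).comp ((isLinearMap_hatE P i).mk' _)).isLinear

/-- The action of a linear operator through the components does not depend on the basis. -/
theorem applyHat_apply (P : Params F) (X : KLType) {A : ((Fin N → F) → F) → ((Fin N → F) → F)}
    (hA : IsLinearMap F A) (Ψ : (Fin N → F) → (Str N → F)) (z : Fin N → F) (α : Str N) :
    applyHat P X A Ψ z α = A (fun z => Ψ z α) z := by
  have h : (fun z => Ψ z α) = ∑ b, klBasis P X b α • component P X Ψ b := by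
    funext z
    have h := congrFun ((klBasis P X).sum_repr (Ψ z)) α
    rw [← h, Finset.sum_apply, Finset.sum_apply]
    exact Finset.sum_congr rfl fun b _ => mul_comm _ _
  have hs := map_sum (hA.mk' A) (fun b => klBasis P X b α • component P X Ψ b) Finset.univ
  simp only [IsLinearMap.mk'_apply, hA.map_smul] at hs
  rw [h, hs, applyHat, Finset.sum_apply, Finset.sum_apply]
  exact Finset.sum_congr rfl fun b _ => mul_comm _ _

/-- The value at `z` involves only `z` and `s_i z`, both in the domain, so values of `f` outside it
are irrelevant. -/
theorem hatE_eq_domainHatE (P : Params F) (hΩ : IsRegularDomain Ω) (i : Fin N)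
    (f : (Fin N → F) → F) (z : Ω) :
    hatE P i f z = domainHatE P hΩ i (fun w => f w) z := by
  simp only [domainHatE_apply, domainReflOp, reflOp_apply, Pi.neg_apply, Pi.add_apply,
    Pi.smul_apply, smul_eq_mul, hatE, hatT, heckeParam, reflCoeff, IsRegularDomain.refl]
  split_ifs with h
  · have h0 := hΩ.ne_zero z z.2 ⟨i.val + 1, h⟩
    have h1 : z.1 ⟨i.val + 1, h⟩ - z.1 i ≠ 0 := sub_ne_zero.2 (hΩ.ne_succ z z.2 i h).symm
    have h2 : 1 - z.1 i * (z.1 ⟨i.val + 1, h⟩)⁻¹ =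
      (z.1 ⟨i.val + 1, h⟩ - z.1 i) / z.1 ⟨i.val + 1, h⟩ := by field_simp
    rw [h2]
    field_simp
    ring
  · ring

/-- The restriction of the operator `ê_{i_l} ⋯ ê_{i_1}` to a regular domain. -/
def domainHatEWord (P : Params F) (hΩ : IsRegularDomain Ω) (l : List (Fin N)) (f : Ω → F) :
    Ω → F :=
  l.foldl (fun g i => domainHatE P hΩ i g) f

theorem hatEWord_eq_domainHatEWord (P : Params F) (hΩ : IsRegularDomain Ω) (l : List (Fin N))
    (f : (Fin N → F) → F) (z : Ω) :
    hatEWord P l f z = domainHatEWord P hΩ l (fun w => f w) z := by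
  induction l generalizing f with
  | nil => rfl
  | cons i l ih =>
    refine (ih (hatE P i f)).trans ?_
    rw [funext fun w : Ω => hatE_eq_domainHatE P hΩ i f w]
    rfl

theorem domainHatEWord_add_smul (P : Params F) (hΩ : IsRegularDomain Ω) (l : List (Fin N))
    (a b : F) (f g : Ω → F) :
    domainHatEWord P hΩ l (a • f + b • g) =
      a • domainHatEWord P hΩ l f + b • domainHatEWord P hΩ l g := by
  induction l generalizing f g with
  | nil => rfl
  | cons i l ih =>
    refine Eq.trans ?_ (ih (domainHatE P hΩ i f) (domainHatE P hΩ i g))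
    rw [← map_smul, ← map_smul, ← map_add]
    rfl

/-- The innermost `ê` is traded for matrix coefficients, which commute with the remaining `ê`; it
thus becomes the outermost `e`. Hence the opposite orders of the two words. -/
theorem IsSolution.eWord_apply {P : Params F} {hΩ : IsRegularDomain Ω} {ψ : Str N → Ω → F}
    (h : IsSolution P hΩ ψ) (l : List (Fin N)) (α : Str N) (z : Ω) :
    eWord P l (fun β => ψ β z) α = domainHatEWord P hΩ l (ψ α) z := by
  induction l generalizing α with
  | nil => rfl
  | cons i l ih =>
    have h1 : domainHatEWord P hΩ (i :: l) (ψ α) =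
        domainHatEWord P hΩ l (domainHatE P hΩ i (ψ α)) := rfl
    have h2 : eWord P (i :: l) (fun β => ψ β z) = e P i (eWord P l fun β => ψ β z) := rfl
    rw [h1, h2, h, domainHatEWord_add_smul, e_apply, ih, ih]
    rfl

theorem eDiag_b0 (P : Params F) {i : Fin N} (h : i.val + 1 < N) : eDiag P i (b0 N) = 0 := by
  rw [eDiag, dif_pos h]
  rfl

theorem eOff_b0 (P : Params F) {i : Fin N} (h : i.val + 1 < N) : eOff P i (b0 N) = 0 := by
  rw [eOff, dif_pos h]
  rfl

/-- The reduced equations at `b₀` determine a solution. -/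
theorem isSolution_of_reduced (P : Params F) (hΩ : IsRegularDomain Ω) {ψ : Str N → Ω → F}
    (h0 : ∀ i : Fin N, i.val + 1 < N → domainHatE P hΩ i (ψ (b0 N)) = 0)
    {p : Str N → List (Fin N)}
    (hp : ∀ v : Str N, toLex v < toLex (b0 N) → IsPath (b0 N) v (p v))
    (h : ∀ v : Str N, toLex v < toLex (b0 N) → ∀ z : Ω,
      eWord P (p v) (fun β => ψ β z) (b0 N) = domainHatEWord P hΩ (p v) (ψ (b0 N)) z) :
    IsSolution P hΩ ψ := by
  obtain ⟨φ, hφ, hφ0⟩ := exists_isSolution P hΩ h0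
  suffices ∀ a : Lex (Str N), ψ (ofLex a) = φ (ofLex a) by
    rwa [show ψ = φ from funext fun v => this (toLex v)]
  intro a
  induction a using (wellFounded_gt (α := Lex (Str N))).induction with
  | _ a ih =>
    by_cases ha : ofLex a = b0 N
    · rw [ha, hφ0]
    · have hlt := lt_b0_iff.2 ha
      obtain ⟨c, hc, hpath⟩ := (hp _ hlt).exists_eWord_b0 P
      funext z
      -- The difference vanishes above the current string. Its path equation has right-hand side
      -- zero, because that side depends only on the common component at `b₀`.
      have hz := hpath ((fun β => ψ β z) - fun β => φ β z) fun u hu =>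
        sub_eq_zero.2 (congrFun (ih (toLex u) hu) z)
      rw [eWord_sub, Pi.sub_apply, h _ hlt, hφ.eWord_apply, hφ0, sub_self] at hz
      exact sub_eq_zero.1 ((mul_eq_zero.1 hz.symm).resolve_left hc)

theorem nonAffineQKZ_iff_isSolution (P : Params F) (X : KLType) (hΩ : IsRegularDomain Ω)
    (Ψ : (Fin N → F) → (Str N → F)) :
    NonAffineQKZ P X Ω Ψ ↔ IsSolution P hΩ fun α (z : Ω) => Ψ z α := by
  have key : ∀ (i : Fin N) (z : Ω) (α : Str N), e P i (Ψ z) α = applyHat P X (hatE P i) Ψ z α ↔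
      domainHatE P hΩ i (fun w : Ω => Ψ w α) z =
        eDiag P i α * Ψ z α + eOff P i α * Ψ z (sStr i α) := fun i z α => by
    rw [applyHat_apply P X (isLinearMap_hatE P i), e_apply, hatE_eq_domainHatE P hΩ, eq_comm]
  constructor
  · exact fun h i α => funext fun z => (key i z α).1 (congrFun (h i z z.2) α)
  · exact fun h i z hz => funext fun α => (key i ⟨z, hz⟩ α).2 (congrFun (h i α) ⟨z, hz⟩)

theorem component_b0 (P : Params F) (X : KLType) (Ψ : (Fin N → F) → (Str N → F)) :
    component P X Ψ (b0 N) = fun z => Ψ z (b0 N) :=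
  funext fun z => klBasis_repr_b0 P X (Ψ z)

theorem NonAffineQKZ.reducedVecEq {P : Params F} {X : KLType} (hΩ : IsRegularDomain Ω)
    {Ψ : (Fin N → F) → (Str N → F)} (h : NonAffineQKZ P X Ω Ψ) (p : Str N → List (Fin N)) :
    ∀ k, ReducedVecEq P X Ω Ψ p k := by
  have hs := (nonAffineQKZ_iff_isSolution P X hΩ Ψ).1 h
  rintro (⟨i, hi⟩ | ⟨v, hv⟩) z hz
  · have := congrFun (hs i (b0 N)) ⟨z, hz⟩
    rw [eDiag_b0 P hi, eOff_b0 P hi, zero_smul, zero_smul, add_zero] at this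
    rw [component_b0]
    exact (hatE_eq_domainHatE P hΩ i _ ⟨z, hz⟩).trans this
  · funext α
    rw [applyHat_apply P X (isLinearMap_hatEWord P _)]
    exact (hs.eWord_apply _ α ⟨z, hz⟩).trans (hatEWord_eq_domainHatEWord P hΩ _ (fun z => Ψ z α) ⟨z, hz⟩).symm

theorem ReducedVecEq.reducedEq {P : Params F} {X : KLType}
    {Ψ : (Fin N → F) → (Str N → F)} {p : Str N → List (Fin N)} {k : ReducedIndex N}
    (h : ReducedVecEq P X Ω Ψ p k) : ReducedEq P X Ω Ψ p k := by
  rcases k with i | v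
  · exact h
  · intro z hz
    rw [klBasis_repr_b0, component_b0, h z hz, applyHat_apply P X (isLinearMap_hatEWord P _)]

theorem nonAffineQKZ_of_reducedEq {P : Params F} {X : KLType} (hΩ : IsRegularDomain Ω)
    {Ψ : (Fin N → F) → (Str N → F)} {p : Str N → List (Fin N)}
    (hp : ∀ v : Str N, toLex v < toLex (b0 N) → IsPath (b0 N) v (p v))
    (h : ∀ k, ReducedEq P X Ω Ψ p k) : NonAffineQKZ P X Ω Ψ := by
  refine (nonAffineQKZ_iff_isSolution P X hΩ Ψ).2
    (isSolution_of_reduced P hΩ (fun i hi => funext fun z => ?_) hp fun v hv z => ?_)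
  · have := h (.inl ⟨i, hi⟩) z z.2
    rw [component_b0] at this
    exact (hatE_eq_domainHatE P hΩ i _ z).symm.trans this
  · have := h (.inr ⟨v, hv⟩) z z.2
    rw [klBasis_repr_b0, component_b0] at this
    exact this.trans (hatEWord_eq_domainHatEWord P hΩ _ _ z)

end Components
end BoundaryQKZ

theorem mainTheorem4 {F : Type*} [Field F] (N : ℕ) (hN : 1 ≤ N)
    (P : Params F) (X : KLType) (hX : X.Compatible P) :
    Nat.card (ReducedIndex N) = 2 ^ N + N - 2 ∧
    (∀ v : Str N, toLex v < toLex (b0 N) → ∃ l : List (Fin N), IsPath (b0 N) v l) ∧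
    ∀ (Ω : Set (Fin N → F)), IsRegularDomain Ω →
    ∀ (Ψ : (Fin N → F) → (Str N → F)) (p : Str N → List (Fin N)),
      (∀ v : Str N, toLex v < toLex (b0 N) → IsPath (b0 N) v (p v)) →
      (NonAffineQKZ P X Ω Ψ ↔ ∀ k : ReducedIndex N, ReducedEq P X Ω Ψ p k) ∧
      (NonAffineQKZ P X Ω Ψ ↔ ∀ k : ReducedIndex N, ReducedVecEq P X Ω Ψ p k) := by
  refine ⟨card_reducedIndex hN, fun v _ => exists_isPath v, fun Ω hΩ Ψ p hp => ⟨?_, ?_⟩⟩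
  · exact ⟨fun h k => (h.reducedVecEq hΩ p k).reducedEq, nonAffineQKZ_of_reducedEq hΩ hp⟩
  · exact ⟨fun h => h.reducedVecEq hΩ p,
      fun h => nonAffineQKZ_of_reducedEq hΩ hp fun k => (h k).reducedEq⟩
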